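/- For real $\nu>-1$ and $x>0$ let $$I_\nu(x)=\sum_{k=0}^{\infty}\frac{(x/2)^{2k+\nu}}{k!\,\Gamma(k+\nu+1)},\qquad K_\nu(x)=\int_0^\infty e^{-x\cosh t}\cosh(\nu t)\,dt$$ be the modified Bessel functions of the first and second kind, and let $$q_\nu(x)=\frac{I_\nu(x)K_\nu(x)}{1+|\ln x|}.$$ Then $q_\nu$ is strictly increasing on $(0,1]$ for every $\nu\ge\frac12$, and strictly decreasing on $[1,\infty)$ for every $\nu>-1$. Consequently, the inequality $$q_\nu(x)\le q_\nu(1)=I_\nu(1)K_\nu(1)$$ holds for all $x\in(0,1]$ and $\nu\ge\frac12$, and also for all $x\ge1$ and $\nu>-1$. -/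

import Mathlib

/-- The modified Bessel function of the first kind of real order `ν` at `x > 0`:
`I_ν(x) = ∑ₖ (x/2)^(2k+ν) / (k! Γ(k+ν+1))`. (At poles of the Gamma function the value
`Real.Gamma = 0` gives the usual convention `1/Γ = 0`.) -/
noncomputable def besselI (ν x : ℝ) : ℝ :=
  ∑' k : ℕ, (x / 2) ^ (2 * (k : ℝ) + ν) / ((k.factorial : ℝ) * Real.Gamma ((k : ℝ) + ν + 1))

/-- The modified Bessel function of the second kind of real order `ν` at `x > 0`:
`K_ν(x) = ∫₀^∞ exp(-x cosh t) cosh(ν t) dt`. For `x > 0` the integral converges for every real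
`ν`, integers included. -/
noncomputable def besselK (ν x : ℝ) : ℝ :=
  ∫ t in Set.Ioi (0 : ℝ), Real.exp (-x * Real.cosh t) * Real.cosh (ν * t)

/-- `q_ν(x) = I_ν(x) K_ν(x) / (1 + |ln x|)`. -/
noncomputable def besselQ (ν x : ℝ) : ℝ :=
  besselI ν x * besselK ν x / (1 + |Real.log x|)

/-! Write P = I_ν K_ν. The recurrences give P' = I_{ν+1} K_ν - I_ν K_{ν-1}. On (0,1] the sign of
q_ν' is that of P'(1 - ln x) + P/x. As 1 - ln x ≤ 1/x, and K_{ν-1} ≤ K_ν for ν ≥ 1/2, the term P/x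
absorbs the negative part of P', leaving at least I_{ν+1} K_ν (1 - ln x) > 0. On [1,∞) the
denominator increases strictly, so it suffices that P is antitone. This follows from x I_ν'/I_ν ≤
√(x² + ν²) ≤ -x K_ν'/K_ν; each half is a Turán inequality, obtained by Cauchy–Schwarz for the power
series (`besselSeries_turan`) or the integral (`besselK_sq_le`). -/

open Filter Topology

/-! ### The power series F_ν -/

/-- Coefficients of the entire function `F_ν` with `I_ν(x) = (x/2)^ν F_ν(x²/4)`. -/
noncomputable def besselCoeff (ν : ℝ) (k : ℕ) : ℝ :=
  ((k.factorial : ℝ) * Real.Gamma ((k : ℝ) + ν + 1))⁻¹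

/-- The entire function `F_ν(z) = ∑ₖ z^k / (k! Γ(k+ν+1))`. -/
noncomputable def besselSeries (ν z : ℝ) : ℝ := ∑' k : ℕ, besselCoeff ν k * z ^ k

theorem besselCoeff_pos {ν : ℝ} (hν : -1 < ν) (k : ℕ) : 0 < besselCoeff ν k := by
  have hk : (0 : ℝ) ≤ k := k.cast_nonneg
  have := Real.Gamma_pos_of_pos (show 0 < (k : ℝ) + ν + 1 by linarith)
  unfold besselCoeff
  positivity

theorem succ_mul_besselCoeff_succ (ν : ℝ) (k : ℕ) :
    ((k : ℝ) + 1) * besselCoeff ν (k + 1) = besselCoeff (ν + 1) k := by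
  unfold besselCoeff
  have h1 : ((k : ℝ) + 1) ≠ 0 := by positivity
  have h2 : ((k + 1 : ℕ) : ℝ) + ν + 1 = (k : ℝ) + (ν + 1) + 1 := by push_cast; ring
  rw [h2, Nat.factorial_succ, mul_inv, mul_inv]
  push_cast
  rw [mul_inv]
  field_simp

theorem add_mul_besselCoeff_succ {ν : ℝ} (hν : -1 < ν) (k : ℕ) :
    ((k : ℝ) + ν + 1) * besselCoeff (ν + 1) k = besselCoeff ν k := by
  have hk : (0 : ℝ) ≤ k := k.cast_nonneg
  have h1 : (k : ℝ) + ν + 1 ≠ 0 := by linarith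
  have h3 := (Real.Gamma_pos_of_pos (show 0 < (k : ℝ) + ν + 1 by linarith)).ne'
  have h4 : (k.factorial : ℝ) ≠ 0 := by positivity
  unfold besselCoeff
  rw [show (k : ℝ) + (ν + 1) + 1 = ((k : ℝ) + ν + 1) + 1 by ring, Real.Gamma_add_one h1]
  field_simp

theorem summable_besselCoeff_mul_pow {ν : ℝ} (hν : -1 < ν) (z : ℝ) :
    Summable fun k : ℕ => besselCoeff ν k * z ^ k := by
  refine summable_of_ratio_norm_eventually_le (r := 1 / 2) (by norm_num) ?_
  -- Beyond this threshold k + ν + 1 ≥ 2|z| + 1, so the term ratio |z| / ((k+1)(k+ν+1)) is at most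
  -- 1/2.
  filter_upwards [eventually_ge_atTop ⌈2 * |z| + |ν|⌉₊] with k hk
  have hk' : 2 * |z| + |ν| ≤ k := Nat.ceil_le.1 hk
  have hz := abs_nonneg z
  have hk0 : (0 : ℝ) ≤ k := k.cast_nonneg
  have hν' := neg_abs_le ν
  have e1 := succ_mul_besselCoeff_succ ν k
  have e2 := add_mul_besselCoeff_succ hν k
  have hc := besselCoeff_pos hν (k + 1)
  rw [norm_mul, norm_mul, Real.norm_of_nonneg hc.le, Real.norm_of_nonneg (besselCoeff_pos hν k).le,
    norm_pow, norm_pow, Real.norm_eq_abs, pow_succ, ← e2, ← e1]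
  have h : |z| ≤ 1 / 2 * (((k : ℝ) + ν + 1) * (k + 1)) := by nlinarith [abs_nonneg ν]
  calc besselCoeff ν (k + 1) * (|z| ^ k * |z|)
      ≤ besselCoeff ν (k + 1) * (|z| ^ k * (1 / 2 * (((k : ℝ) + ν + 1) * (k + 1)))) := by gcongr
    _ = _ := by ring

theorem besselSeries_pos {ν z : ℝ} (hν : -1 < ν) (hz : 0 < z) : 0 < besselSeries ν z :=
  (summable_besselCoeff_mul_pow hν z).tsum_pos
    (fun k => mul_nonneg (besselCoeff_pos hν k).le (by positivity)) 0
    (mul_pos (besselCoeff_pos hν 0) (by positivity))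

/-- First moment of the weights c_k z^k; with the second moment below it feeds the Cauchy–Schwarz
argument. -/
theorem hasSum_nat_mul_besselCoeff {ν : ℝ} (hν : -1 < ν) (z : ℝ) :
    HasSum (fun k : ℕ => (k : ℝ) * (besselCoeff ν k * z ^ k)) (z * besselSeries (ν + 1) z) := by
  have h := (summable_besselCoeff_mul_pow (show -1 < ν + 1 by linarith) z).hasSum.mul_left z
  have hshift : (fun k : ℕ => z * (besselCoeff (ν + 1) k * z ^ k)) =
      fun k : ℕ => ((k + 1 : ℕ) : ℝ) * (besselCoeff ν (k + 1) * z ^ (k + 1)) := by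
    funext k
    rw [← succ_mul_besselCoeff_succ]
    push_cast
    ring
  rw [hshift] at h
  simpa [besselSeries] using
    (hasSum_nat_add_iff (f := fun k : ℕ => (k : ℝ) * (besselCoeff ν k * z ^ k)) 1).1 h

theorem hasSum_nat_sq_mul_besselCoeff {ν : ℝ} (hν : -1 < ν) (z : ℝ) :
    HasSum (fun k : ℕ => (k : ℝ) ^ 2 * (besselCoeff ν k * z ^ k))
      (z * (z * besselSeries (ν + 1 + 1) z + besselSeries (ν + 1) z)) := by
  have hν1 : -1 < ν + 1 := by linarith
  have h := ((hasSum_nat_mul_besselCoeff hν1 z).add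
    (summable_besselCoeff_mul_pow hν1 z).hasSum).mul_left z
  have hshift : (fun k : ℕ => z * ((k : ℝ) * (besselCoeff (ν + 1) k * z ^ k) +
      besselCoeff (ν + 1) k * z ^ k)) =
      fun k : ℕ => ((k + 1 : ℕ) : ℝ) ^ 2 * (besselCoeff ν (k + 1) * z ^ (k + 1)) := by
    funext k
    rw [← succ_mul_besselCoeff_succ]
    push_cast
    ring
  rw [hshift] at h
  simpa [besselSeries] using
    (hasSum_nat_add_iff (f := fun k : ℕ => (k : ℝ) ^ 2 * (besselCoeff ν k * z ^ k)) 1).1 h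

theorem hasDerivAt_besselSeries {ν : ℝ} (hν : -1 < ν) (z : ℝ) :
    HasDerivAt (besselSeries ν) (besselSeries (ν + 1) z) z := by
  have hν1 : -1 < ν + 1 := by linarith
  have hsucc (k : ℕ) (y : ℝ) : besselCoeff ν (k + 1) * (((k + 1 : ℕ) : ℝ) * y ^ (k + 1 - 1)) =
      besselCoeff (ν + 1) k * y ^ k := by
    rw [← succ_mul_besselCoeff_succ]
    push_cast
    ring
  have hsum (y : ℝ) : Summable fun k : ℕ => besselCoeff ν k * ((k : ℝ) * y ^ (k - 1)) := by
    rw [← summable_nat_add_iff 1]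
    exact (summable_besselCoeff_mul_pow hν1 y).congr fun k => (hsucc k y).symm
  have hval : ∑' k : ℕ, besselCoeff ν k * ((k : ℝ) * z ^ (k - 1)) = besselSeries (ν + 1) z := by
    rw [(hsum z).tsum_eq_zero_add, besselSeries, tsum_congr fun k => hsucc k z]
    simp
  rw [← hval]
  refine hasDerivAt_tsum_of_isPreconnected (hsum (|z| + 1)) Metric.isOpen_ball
    (convex_ball z 1).isPreconnected (fun k y _ => (hasDerivAt_pow k y).const_mul _) ?_
    (Metric.mem_ball_self one_pos) (summable_besselCoeff_mul_pow hν z)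
    (Metric.mem_ball_self one_pos)
  intro k y hy
  have hy' : |y| ≤ |z| + 1 := by
    rw [Metric.mem_ball, Real.dist_eq] at hy
    have := abs_sub_abs_le_abs_sub y z
    linarith
  rw [norm_mul, norm_mul, norm_pow, Real.norm_of_nonneg (besselCoeff_pos hν k).le,
    Real.norm_of_nonneg (k.cast_nonneg : (0 : ℝ) ≤ k), Real.norm_eq_abs]
  have := (besselCoeff_pos hν k).le
  gcongr

theorem besselSeries_recurrence {ν : ℝ} (hν : -1 < ν) (z : ℝ) :
    besselSeries ν z = (ν + 1) * besselSeries (ν + 1) z + z * besselSeries (ν + 1 + 1) z := by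
  have hν1 : -1 < ν + 1 := by linarith
  have h := ((summable_besselCoeff_mul_pow hν1 z).hasSum.mul_left (ν + 1)).add
    (hasSum_nat_mul_besselCoeff hν1 z)
  have hterm : (fun k : ℕ => (ν + 1) * (besselCoeff (ν + 1) k * z ^ k) +
      (k : ℝ) * (besselCoeff (ν + 1) k * z ^ k)) = fun k : ℕ => besselCoeff ν k * z ^ k := by
    funext k
    rw [← add_mul_besselCoeff_succ hν k]
    ring
  rw [hterm] at h
  exact h.tsum_eq

/-- A Turán type inequality, from the Cauchy–Schwarz inequality for the weights of `F_ν`. -/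
theorem besselSeries_turan {ν z : ℝ} (hν : -1 < ν) (hz : 0 < z) :
    ν * besselSeries ν z * besselSeries (ν + 1) z + z * besselSeries (ν + 1) z ^ 2 ≤
      besselSeries ν z ^ 2 := by
  have hν1 : -1 < ν + 1 := by linarith
  set A := besselSeries ν z with hA
  set B := besselSeries (ν + 1) z with hB
  have hApos : 0 < A := besselSeries_pos hν hz
  have hrec : A = (ν + 1) * B + z * besselSeries (ν + 1 + 1) z := besselSeries_recurrence hν z
  have hCS : (z * B) ^ 2 ≤ A * (z * (z * besselSeries (ν + 1 + 1) z + B)) := by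
    -- Sum of c_k z^k (A k - zB)² ≥ 0, where A is the total mass and zB the first moment.
    have h := (((hasSum_nat_sq_mul_besselCoeff hν z).mul_left (A ^ 2)).sub
      ((hasSum_nat_mul_besselCoeff hν z).mul_left (2 * A * (z * B)))).add
      ((summable_besselCoeff_mul_pow hν z).hasSum.mul_left ((z * B) ^ 2))
    have h0 := h.nonneg fun k => by
      have := mul_nonneg (besselCoeff_pos hν k).le (pow_nonneg hz.le k)
      have := mul_nonneg (sq_nonneg (A * k - z * B)) this
      linarith
    change 0 ≤ A ^ 2 * (z * (z * besselSeries (ν + 1 + 1) z + B)) - 2 * A * (z * B) * (z * B) +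
      (z * B) ^ 2 * A at h0
    have h1 : 0 ≤ A * (A * (z * (z * besselSeries (ν + 1 + 1) z + B)) - (z * B) ^ 2) := by
      linarith
    linarith [nonneg_of_mul_nonneg_right h1 hApos]
  have h2 : z * besselSeries (ν + 1 + 1) z + B = A - ν * B := by linarith
  rw [h2] at hCS
  have h3 : 0 ≤ z * (A * (A - ν * B) - z * B ^ 2) := by linarith
  linarith [nonneg_of_mul_nonneg_right h3 hz]

/-! ### The function I_ν -/

theorem besselI_eq (ν : ℝ) {x : ℝ} (hx : 0 < x) :
    besselI ν x = (x / 2) ^ ν * besselSeries ν (x ^ 2 / 4) := by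
  rw [besselI, besselSeries, ← tsum_mul_left]
  refine tsum_congr fun k => ?_
  rw [add_comm, Real.rpow_add (by positivity), Real.rpow_mul (by positivity), Real.rpow_natCast,
    besselCoeff, show (x / 2) ^ (2 : ℝ) = x ^ 2 / 4 by norm_num [div_pow]]
  ring

theorem besselI_pos {ν x : ℝ} (hν : -1 < ν) (hx : 0 < x) : 0 < besselI ν x := by
  rw [besselI_eq ν hx]
  exact mul_pos (by positivity) (besselSeries_pos hν (by positivity))

theorem besselI_succ_eq (ν : ℝ) {x : ℝ} (hx : 0 < x) :
    besselI (ν + 1) x = (x / 2) ^ ν * (x / 2 * besselSeries (ν + 1) (x ^ 2 / 4)) := by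
  rw [besselI_eq _ hx, Real.rpow_add_one (by positivity)]
  ring

theorem hasDerivAt_besselI {ν x : ℝ} (hν : -1 < ν) (hx : 0 < x) :
    HasDerivAt (besselI ν) (ν / x * besselI ν x + besselI (ν + 1) x) x := by
  have hpow : HasDerivAt (fun y : ℝ => (y / 2) ^ ν) (ν / x * (x / 2) ^ ν) x := by
    have h := ((hasDerivAt_id x).div_const 2).rpow_const (p := ν) (Or.inl (by simpa using hx.ne'))
    refine h.congr_deriv ?_
    rw [id, Real.rpow_sub_one (by positivity)]
    field_simp
  have hser : HasDerivAt (fun y : ℝ => besselSeries ν (y ^ 2 / 4))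
      (besselSeries (ν + 1) (x ^ 2 / 4) * (x / 2)) x := by
    have h := ((hasDerivAt_pow 2 x).div_const 4)
    refine ((hasDerivAt_besselSeries hν (x ^ 2 / 4)).comp x h).congr_deriv ?_
    norm_num
    ring_nf
    simp
  refine ((hpow.mul hser).congr_of_eventuallyEq ?_).congr_deriv ?_
  · filter_upwards [lt_mem_nhds hx] with y hy using besselI_eq ν hy
  · rw [besselI_succ_eq ν hx, besselI_eq ν hx]
    ring

/-- `(x I_ν')² ≤ (x² + ν²) I_ν²`. -/
theorem sq_mul_deriv_besselI_le {ν x : ℝ} (hν : -1 < ν) (hx : 0 < x) :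
    (ν * besselI ν x + x * besselI (ν + 1) x) ^ 2 ≤ (x ^ 2 + ν ^ 2) * besselI ν x ^ 2 := by
  have h := besselSeries_turan hν (show 0 < x ^ 2 / 4 by positivity)
  rw [besselI_succ_eq ν hx, besselI_eq ν hx]
  have h2 := mul_nonneg (mul_nonneg (sq_nonneg ((x / 2) ^ ν)) (sq_nonneg x)) (sub_nonneg.2 h)
  linarith

/-! ### The function K_ν -/

theorem sq_div_four_le_cosh {t : ℝ} (ht : 0 ≤ t) : t ^ 2 / 4 ≤ Real.cosh t := by
  have h := Real.quadratic_le_exp_of_nonneg ht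
  have := Real.exp_pos (-t)
  rw [Real.cosh_eq]
  linarith

theorem cosh_mul_le_exp (ν : ℝ) {t : ℝ} (ht : 0 ≤ t) : Real.cosh (ν * t) ≤ Real.exp (|ν| * t) := by
  have h1 : ν * t ≤ |ν| * t := by gcongr; exact le_abs_self ν
  have h2 : -(ν * t) ≤ |ν| * t := by
    rw [← neg_mul]
    gcongr
    exact neg_le_abs ν
  rw [Real.cosh_eq]
  linarith [Real.exp_le_exp.2 h1, Real.exp_le_exp.2 h2]

theorem integrableOn_besselK (ν : ℝ) {x : ℝ} (hx : 0 < x) :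
    MeasureTheory.IntegrableOn
      (fun t => Real.exp (-x * Real.cosh t) * Real.cosh (ν * t)) (Set.Ioi 0) := by
  -- With cosh t ≥ t²/4, completing the square gives (|ν|+1)t - x t²/4 ≤ (|ν|+1)²/x.
  have hg : MeasureTheory.IntegrableOn
      (fun t : ℝ => Real.exp ((|ν| + 1) ^ 2 / x) * Real.exp (-t)) (Set.Ioi 0) :=
    (integrableOn_exp_neg_Ioi 0).const_mul _
  refine hg.mono' (by fun_prop) ?_
  filter_upwards [MeasureTheory.ae_restrict_mem measurableSet_Ioi] with t ht
  have ht0 : 0 ≤ t := le_of_lt ht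
  rw [Real.norm_of_nonneg (mul_nonneg (Real.exp_pos _).le (Real.cosh_pos _).le), ← Real.exp_add]
  refine (mul_le_mul_of_nonneg_left (cosh_mul_le_exp ν ht0) (Real.exp_pos _).le).trans ?_
  rw [← Real.exp_add, Real.exp_le_exp]
  have h1 := mul_le_mul_of_nonneg_left (sq_div_four_le_cosh ht0) hx.le
  have h2 : (|ν| + 1) ^ 2 / x - (|ν| + 1) * t + x * (t ^ 2 / 4) =
      ((|ν| + 1) - x * t / 2) ^ 2 / x := by
    field_simp
    ring
  have h3 : 0 ≤ ((|ν| + 1) - x * t / 2) ^ 2 / x := by positivity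
  linarith

theorem setIntegral_Ioi_pos_of_forall_pos {f : ℝ → ℝ}
    (hf : MeasureTheory.IntegrableOn f (Set.Ioi 0)) (hpos : ∀ t, 0 < f t) :
    0 < ∫ t in Set.Ioi (0 : ℝ), f t := by
  rw [MeasureTheory.setIntegral_pos_iff_support_of_nonneg_ae (MeasureTheory.ae_of_all _ fun t => (hpos t).le) hf,
    show Function.support f = Set.univ from Set.eq_univ_of_forall fun t => (hpos t).ne']
  simp

theorem besselK_pos (ν : ℝ) {x : ℝ} (hx : 0 < x) : 0 < besselK ν x :=
  setIntegral_Ioi_pos_of_forall_pos (integrableOn_besselK ν hx)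
    fun _ => mul_pos (Real.exp_pos _) (Real.cosh_pos _)

theorem cosh_add_one_mul_add_cosh_sub_one_mul (ν t : ℝ) :
    Real.cosh ((ν + 1) * t) + Real.cosh ((ν - 1) * t) = 2 * (Real.cosh t * Real.cosh (ν * t)) := by
  rw [add_mul, sub_mul, one_mul, Real.cosh_add, Real.cosh_sub]
  ring

theorem hasDerivAt_besselK (ν : ℝ) {x : ℝ} (hx : 0 < x) :
    HasDerivAt (besselK ν) (-((besselK (ν + 1) x + besselK (ν - 1) x) / 2)) x := by
  have hhalf {y : ℝ} (hy : 0 < y) : MeasureTheory.IntegrableOn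
      (fun t => Real.cosh t * (Real.exp (-y * Real.cosh t) * Real.cosh (ν * t))) (Set.Ioi 0) := by
    refine (((integrableOn_besselK (ν + 1) hy).add (integrableOn_besselK (ν - 1) hy)).div_const
      2).congr (MeasureTheory.ae_of_all _ fun t => ?_)
    simp only [Pi.add_apply]
    rw [← mul_add, cosh_add_one_mul_add_cosh_sub_one_mul]
    ring
  have h := (hasDerivAt_integral_of_dominated_loc_of_deriv_le
    (μ := MeasureTheory.volume.restrict (Set.Ioi (0 : ℝ)))
    (F := fun y t => Real.exp (-y * Real.cosh t) * Real.cosh (ν * t))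
    (F' := fun y t => -(Real.cosh t * (Real.exp (-y * Real.cosh t) * Real.cosh (ν * t))))
    -- For y > x/2 the derivative is dominated by its size at y = x/2.
    (s := Set.Ioi (x / 2)) (Ioi_mem_nhds (by linarith)) (Eventually.of_forall fun y => by fun_prop)
    (integrableOn_besselK ν hx) (by fun_prop)
    (MeasureTheory.ae_of_all _ fun t y hy => ?_) (hhalf (half_pos hx)) (MeasureTheory.ae_of_all _ fun t y _ => ?_)).2
  · refine h.congr_deriv ?_
    rw [besselK, besselK, ← MeasureTheory.integral_add (integrableOn_besselK _ hx)
      (integrableOn_besselK _ hx), ← MeasureTheory.integral_div, ← MeasureTheory.integral_neg]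
    refine MeasureTheory.integral_congr_ae (MeasureTheory.ae_of_all _ fun t => ?_)
    simp only
    rw [← mul_add, cosh_add_one_mul_add_cosh_sub_one_mul]
    ring
  · have hc := (Real.cosh_pos t).le
    have hc' := (Real.cosh_pos (ν * t)).le
    have hy' : x / 2 ≤ y := le_of_lt hy
    rw [norm_neg, Real.norm_of_nonneg (by positivity)]
    gcongr
  · have h1 : HasDerivAt (fun y : ℝ => -y * Real.cosh t) (-1 * Real.cosh t) y :=
      (hasDerivAt_neg y).mul_const _
    exact (h1.exp.mul_const _).congr_deriv (by ring)

theorem abs_sinh_le_cosh (t : ℝ) : |Real.sinh t| ≤ Real.cosh t := by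
  rw [abs_le]
  have h1 := Real.cosh_add_sinh t
  have h2 := Real.cosh_sub_sinh t
  constructor <;> linarith [Real.exp_pos t, Real.exp_pos (-t)]

/-- Integrate the derivative of e^{-x cosh t} sinh(νt): it vanishes at 0, and at infinity since it
and its derivative are integrable. -/
theorem two_mul_besselK (ν : ℝ) {x : ℝ} (hx : 0 < x) :
    2 * ν * besselK ν x = x * (besselK (ν + 1) x - besselK (ν - 1) x) := by
  have hK := integrableOn_besselK ν hx
  have hKp := integrableOn_besselK (ν + 1) hx
  have hKm := integrableOn_besselK (ν - 1) hx
  have hderiv (t : ℝ) : HasDerivAt (fun t => Real.exp (-x * Real.cosh t) * Real.sinh (ν * t))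
      (ν * (Real.exp (-x * Real.cosh t) * Real.cosh (ν * t)) -
        x / 2 * (Real.exp (-x * Real.cosh t) * Real.cosh ((ν + 1) * t) -
          Real.exp (-x * Real.cosh t) * Real.cosh ((ν - 1) * t))) t := by
    have h1 := ((Real.hasDerivAt_cosh t).const_mul (-x)).exp
    have h2 := ((hasDerivAt_id t).const_mul ν).sinh
    refine (h1.mul h2).congr_deriv ?_
    rw [add_mul, sub_mul, one_mul, Real.cosh_add, Real.cosh_sub]
    simp only [id]
    ring
  have hD : MeasureTheory.IntegrableOn
      (fun t => Real.exp (-x * Real.cosh t) * Real.cosh ((ν + 1) * t) -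
        Real.exp (-x * Real.cosh t) * Real.cosh ((ν - 1) * t)) (Set.Ioi 0) := hKp.sub hKm
  have hint := (hK.const_mul ν).sub (hD.const_mul (x / 2))
  have hfint : MeasureTheory.IntegrableOn
      (fun t => Real.exp (-x * Real.cosh t) * Real.sinh (ν * t)) (Set.Ioi 0) := by
    refine hK.mono' (by fun_prop) (MeasureTheory.ae_of_all _ fun t => ?_)
    rw [norm_mul, Real.norm_of_nonneg (Real.exp_pos _).le, Real.norm_eq_abs]
    gcongr
    exact abs_sinh_le_cosh _
  have hlim := MeasureTheory.tendsto_zero_of_hasDerivAt_of_integrableOn_Ioi (a := (0 : ℝ))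
    (fun t _ => hderiv t) hint hfint
  have h := MeasureTheory.integral_Ioi_of_hasDerivAt_of_tendsto' (a := (0 : ℝ))
    (fun t _ => hderiv t) hint hlim
  rw [MeasureTheory.integral_sub (hK.const_mul ν) (hD.const_mul (x / 2)),
    MeasureTheory.integral_const_mul, MeasureTheory.integral_const_mul,
    MeasureTheory.integral_sub hKp hKm] at h
  simp only [mul_zero, Real.sinh_zero, sub_zero] at h
  change ν * besselK ν x - x / 2 * (besselK (ν + 1) x - besselK (ν - 1) x) = 0 at h
  linarith

/-- The Turán inequality `K_ν² ≤ K_{ν+1} K_{ν-1}`. -/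
theorem besselK_sq_le (ν : ℝ) {x : ℝ} (hx : 0 < x) :
    besselK ν x ^ 2 ≤ besselK (ν + 1) x * besselK (ν - 1) x := by
  have hK := integrableOn_besselK ν hx
  have hKp := integrableOn_besselK (ν + 1) hx
  have hKm := integrableOn_besselK (ν - 1) hx
  have hquad (a b : ℝ) : 0 ≤ a ^ 2 * besselK (ν + 1) x - 2 * a * b * besselK ν x +
      b ^ 2 * besselK (ν - 1) x := by
    have h : 0 ≤ ∫ t in Set.Ioi (0 : ℝ),
        (a ^ 2 * (Real.exp (-x * Real.cosh t) * Real.cosh ((ν + 1) * t)) -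
          2 * a * b * (Real.exp (-x * Real.cosh t) * Real.cosh (ν * t)) +
          b ^ 2 * (Real.exp (-x * Real.cosh t) * Real.cosh ((ν - 1) * t))) := by
      refine MeasureTheory.integral_nonneg fun t => ?_
      have hkey : 0 ≤ a ^ 2 * Real.cosh ((ν + 1) * t) - 2 * a * b * Real.cosh (ν * t) +
          b ^ 2 * Real.cosh ((ν - 1) * t) := by
        have h1 : Real.cosh ((ν + 1) * t) =
            (Real.exp (ν * t) * Real.exp (t / 2) ^ 2 +
              Real.exp (-(ν * t)) * Real.exp (-(t / 2)) ^ 2) / 2 := by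
          rw [Real.cosh_eq, ← Real.exp_nat_mul, ← Real.exp_nat_mul, ← Real.exp_add, ← Real.exp_add]
          congr 3 <;> push_cast <;> ring
        have h2 : Real.cosh ((ν - 1) * t) =
            (Real.exp (ν * t) * Real.exp (-(t / 2)) ^ 2 +
              Real.exp (-(ν * t)) * Real.exp (t / 2) ^ 2) / 2 := by
          rw [Real.cosh_eq, ← Real.exp_nat_mul, ← Real.exp_nat_mul, ← Real.exp_add, ← Real.exp_add]
          congr 3 <;> push_cast <;> ring
        have h3 : Real.exp (t / 2) * Real.exp (-(t / 2)) = 1 := by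
          rw [← Real.exp_add, add_neg_cancel, Real.exp_zero]
        -- Half the sum of these two squares is the quadratic form in a, b.
        have h4 := mul_nonneg (Real.exp_pos (ν * t)).le
          (sq_nonneg (a * Real.exp (t / 2) - b * Real.exp (-(t / 2))))
        have h5 := mul_nonneg (Real.exp_pos (-(ν * t))).le
          (sq_nonneg (a * Real.exp (-(t / 2)) - b * Real.exp (t / 2)))
        rw [h1, h2, Real.cosh_eq]
        linear_combination (h4 + h5) / 2 -
          (a * b * (Real.exp (ν * t) + Real.exp (-(ν * t)))) * h3
      have := mul_nonneg (Real.exp_pos (-x * Real.cosh t)).le hkey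
      simp only [Pi.zero_apply]
      linarith
    have hD : MeasureTheory.IntegrableOn
        (fun t => a ^ 2 * (Real.exp (-x * Real.cosh t) * Real.cosh ((ν + 1) * t)) -
          2 * a * b * (Real.exp (-x * Real.cosh t) * Real.cosh (ν * t))) (Set.Ioi 0) :=
      (hKp.const_mul _).sub (hK.const_mul _)
    rw [MeasureTheory.integral_add hD (hKm.const_mul _),
      MeasureTheory.integral_sub (hKp.const_mul _) (hK.const_mul _),
      MeasureTheory.integral_const_mul, MeasureTheory.integral_const_mul,
      MeasureTheory.integral_const_mul] at h
    exact h
  have hpos := besselK_pos (ν - 1) hx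
  -- The choice a = K_{ν-1}, b = K_ν turns the form into K_{ν-1} times the discriminant gap.
  have h := hquad (besselK (ν - 1) x) (besselK ν x)
  have h1 : 0 ≤ besselK (ν - 1) x *
      (besselK (ν + 1) x * besselK (ν - 1) x - besselK ν x ^ 2) := by linarith
  linarith [nonneg_of_mul_nonneg_right h1 hpos]

/-- The threshold 1/2 is exactly the condition |ν - 1| ≤ |ν|. -/
theorem besselK_sub_one_le {ν x : ℝ} (hν : 1 / 2 ≤ ν) (hx : 0 < x) :
    besselK (ν - 1) x ≤ besselK ν x := by
  refine MeasureTheory.integral_mono (integrableOn_besselK _ hx) (integrableOn_besselK _ hx)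
    fun t => ?_
  have h : |(ν - 1) * t| ≤ |ν * t| := by
    rw [abs_mul, abs_mul]
    refine mul_le_mul_of_nonneg_right ?_ (abs_nonneg t)
    rw [abs_of_nonneg (show 0 ≤ ν by linarith), abs_le]
    constructor <;> linarith
  exact mul_le_mul_of_nonneg_left (Real.cosh_le_cosh.2 h) (Real.exp_pos _).le

/-! ### The product I_ν K_ν -/

theorem hasDerivAt_besselI_mul_besselK {ν x : ℝ} (hν : -1 < ν) (hx : 0 < x) :
    HasDerivAt (fun y => besselI ν y * besselK ν y)
      (besselI (ν + 1) x * besselK ν x - besselI ν x * besselK (ν - 1) x) x := by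
  refine ((hasDerivAt_besselI hν hx).mul (hasDerivAt_besselK ν hx)).congr_deriv ?_
  have h : besselK (ν + 1) x = 2 * ν / x * besselK ν x + besselK (ν - 1) x := by
    have := two_mul_besselK ν hx
    field_simp
    linarith
  rw [h]
  ring

theorem deriv_besselI_mul_besselK_nonpos {ν x : ℝ} (hν : -1 < ν) (hx : 0 < x) :
    besselI (ν + 1) x * besselK ν x - besselI ν x * besselK (ν - 1) x ≤ 0 := by
  have hI := besselI_pos hν hx
  have hK := besselK_pos ν hx
  have hKp := besselK_pos (ν + 1) hx
  have hKm := besselK_pos (ν - 1) hx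
  have hrec := two_mul_besselK ν hx
  have hA := sq_mul_deriv_besselI_le hν hx
  have hB : (x ^ 2 + ν ^ 2) * besselK ν x ^ 2 ≤ (ν * besselK ν x + x * besselK (ν - 1) x) ^ 2 := by
    have h1 : (ν * besselK ν x + x * besselK (ν - 1) x) ^ 2 =
        ν ^ 2 * besselK ν x ^ 2 + x ^ 2 * (besselK (ν + 1) x * besselK (ν - 1) x) := by
      linear_combination (x * besselK (ν - 1) x) * hrec
    have h2 := mul_le_mul_of_nonneg_left (besselK_sq_le ν hx) (sq_nonneg x)
    linarith
  have hpos : 0 ≤ ν * besselK ν x + x * besselK (ν - 1) x := by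
    have : ν * besselK ν x + x * besselK (ν - 1) x =
        x * (besselK (ν + 1) x + besselK (ν - 1) x) / 2 := by linarith
    rw [this]
    positivity
  have hle : (ν * besselI ν x + x * besselI (ν + 1) x) * besselK ν x ≤
      (ν * besselK ν x + x * besselK (ν - 1) x) * besselI ν x := by
    -- Only the right side, -x K_ν' I_ν, needs a sign; x I_ν' may be negative when ν < 0.
    refine le_of_sq_le_sq ?_ (by positivity)
    have h1 := mul_le_mul_of_nonneg_right hA (sq_nonneg (besselK ν x))
    have h2 := mul_le_mul_of_nonneg_right hB (sq_nonneg (besselI ν x))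
    linarith
  have : x * (besselI (ν + 1) x * besselK ν x - besselI ν x * besselK (ν - 1) x) ≤ 0 := by linarith
  exact nonpos_of_mul_nonpos_right this hx

theorem antitoneOn_besselI_mul_besselK {ν : ℝ} (hν : -1 < ν) :
    AntitoneOn (fun x => besselI ν x * besselK ν x) (Set.Ioi 0) := by
  refine antitoneOn_of_deriv_nonpos (convex_Ioi 0)
    (fun x hx => (hasDerivAt_besselI_mul_besselK hν hx).continuousAt.continuousWithinAt)
    (fun x hx => ?_) fun x hx => ?_ <;> rw [interior_Ioi] at hx
  · exact (hasDerivAt_besselI_mul_besselK hν hx).differentiableAt.differentiableWithinAt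
  · rw [(hasDerivAt_besselI_mul_besselK hν hx).deriv]
    exact deriv_besselI_mul_besselK_nonpos hν hx

/-! ### Monotonicity of q_ν -/

theorem strictAntiOn_besselQ {ν : ℝ} (hν : -1 < ν) : StrictAntiOn (besselQ ν) (Set.Ici 1) := by
  intro x hx y hy hxy
  rw [Set.mem_Ici] at hx hy
  have hx0 : 0 < x := by linarith
  have hy0 : 0 < y := by linarith
  have hlog := Real.log_lt_log hx0 hxy
  have hlx := Real.log_nonneg hx
  have hP := antitoneOn_besselI_mul_besselK hν hx0 hy0 hxy.le
  have hPpos := mul_pos (besselI_pos hν hx0) (besselK_pos ν hx0)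
  rw [besselQ, besselQ, abs_of_nonneg hlx, abs_of_nonneg (hlx.trans hlog.le)]
  exact div_lt_div₀' hP (by linarith) hPpos (by linarith)

theorem strictMonoOn_besselQ {ν : ℝ} (hν : 1 / 2 ≤ ν) :
    StrictMonoOn (besselQ ν) (Set.Ioc 0 1) := by
  have hν' : -1 < ν := by linarith
  have hmono : StrictMonoOn (fun x => besselI ν x * besselK ν x / (1 - Real.log x))
      (Set.Ioc 0 1) := by
    have hden {x : ℝ} (hx : x ∈ Set.Ioc (0 : ℝ) 1) : 0 < 1 - Real.log x := by
      linarith [Real.log_nonpos hx.1.le hx.2]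
    have hderiv {x : ℝ} (hx : x ∈ Set.Ioc (0 : ℝ) 1) :=
      (hasDerivAt_besselI_mul_besselK hν' hx.1).div
        ((Real.hasDerivAt_log hx.1.ne').const_sub 1) (hden hx).ne'
    refine strictMonoOn_of_deriv_pos (convex_Ioc 0 1)
      (fun x hx => (hderiv hx).continuousAt.continuousWithinAt) fun x hx => ?_
    have hx := interior_subset hx
    have hx0 : 0 < x := hx.1
    refine ((hderiv hx).deriv).symm ▸ div_pos ?_ (pow_pos (hden hx) 2)
    have hI := besselI_pos hν' hx0
    have hI1 := besselI_pos (show -1 < ν + 1 by linarith) hx0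
    have hK := besselK_pos ν hx0
    have hKle := mul_le_mul_of_nonneg_left (besselK_sub_one_le hν hx0) hI.le
    have hlog : 1 - Real.log x ≤ x⁻¹ := by linarith [Real.one_sub_inv_le_log_of_pos hx0]
    have h1 := mul_le_mul_of_nonneg_left hlog (mul_pos hI hK).le
    have h2 := mul_pos (mul_pos hI1 hK) (hden hx)
    have h3 := mul_le_mul_of_nonneg_right hKle (hden hx).le
    linarith
  refine hmono.congr fun x hx => ?_
  rw [besselQ, abs_of_nonpos (Real.log_nonpos hx.1.le hx.2), ← sub_eq_add_neg]

theorem theorem5 :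
    (∀ ν : ℝ, 1 / 2 ≤ ν → StrictMonoOn (besselQ ν) (Set.Ioc 0 1)) ∧
    (∀ ν : ℝ, -1 < ν → StrictAntiOn (besselQ ν) (Set.Ici 1)) ∧
    (∀ ν : ℝ, -1 < ν → besselQ ν 1 = besselI ν 1 * besselK ν 1) ∧
    (∀ ν : ℝ, 1 / 2 ≤ ν → ∀ x ∈ Set.Ioc (0 : ℝ) 1, besselQ ν x ≤ besselQ ν 1) ∧
    (∀ ν : ℝ, -1 < ν → ∀ x ∈ Set.Ici (1 : ℝ), besselQ ν x ≤ besselQ ν 1) := by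
  refine ⟨fun ν => strictMonoOn_besselQ, fun ν => strictAntiOn_besselQ, fun ν _ => ?_,
    fun ν hν x hx => ?_, fun ν hν x hx => ?_⟩
  · simp [besselQ]
  · exact (strictMonoOn_besselQ hν).monotoneOn hx ⟨one_pos, le_rfl⟩ hx.2
  · exact (strictAntiOn_besselQ hν).antitoneOn (Set.mem_Ici.2 le_rfl) hx hx
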